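/- Let $(X,\|\cdot\|)$ be a normed space over $\mathbb{K}=\mathbb{R}$ or $\mathbb{C}$ (not assumed complete), with norm topology $\tau_{\|\cdot\|}$, closed unit ball $B_{\|\cdot\|}=\{x\in X : \|x\|\le 1\}$ and normed dual $X^{\ast}$. We use the following notions. - An isometric Banach predual of $X$ is a pair $(Y,\varphi)$ of a Banach space $Y$ and an isometric isomorphism $\varphi\colon X\to Y^{\ast}$. - For a locally convex Hausdorff space $Y$, let $Y_b'$ be its topological dual $Y'$ with the topology of uniform convergence on bounded subsets of $Y$. An isometric prebidual of $X$ is a pair $(Y,\varphi)$ of a locally convex Hausdorff space $Y$, such that $Y_b'$ is completely normable (there is a complete norm $|||\cdot|||$ on $Y'$ inducing the topology of $Y_b'$), and an isometric isomorphism $\varphi\colon X\to (Y',|||\cdot|||)^{\ast}$ for such a norm. It is called complete semi-Montel if $Y$ is complete and every bounded subset of $Y$ is relatively compact. - For a locally convex Hausdorff topology $\tau\le\tau_{\|\cdot\|}$ on $X$ (where $\le$ means "coarser than"), the mixed topology $\gamma=\gamma(\|\cdot\|,\tau)$ is the finest linear topology on $X$ with $\tau\le\gamma\le\tau_{\|\cdot\|}$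 that coincides with $\tau$ on $\|\cdot\|$-bounded sets. The triple $(X,\|\cdot\|,\tau)$ is a Saks space if $\tau$ is generated by a directed system $\Gamma_\tau$ of continuous seminorms with $\|x\|=\sup_{q\in\Gamma_\tau}q(x)$ for all $x\in X$. A Saks space is semi-reflexive if $(X,\gamma)$ is semi-reflexive (the evaluation map $(X,\gamma)\to((X,\gamma)_b')'$ is surjective), and semi-Montel if every bounded subset of $(X,\gamma)$ is relatively compact. - For a linear subspace $V\subset X^{\ast}$, $\sigma(X,V)$ is the topology on $X$ of pointwise convergence on $V$. Then the following assertions are equivalent. (a) $(X,\|\cdot\|)$ has an isometric Banach predual. (b) $(X,\|\cdot\|)$ has an isometric complete semi-Montel prebidual $(Y,\varphi)$. (c) $(X,\|\cdot\|)$ has an isometric prebidual $(Y,\varphi)$. (d) $(X,\|\cdot\|,\tau)$ is a semi-reflexive Saks space for some locally convex Hausdorff topology $\tau\le\tau_{\|\cdot\|}$. (e) $(X,\|\cdot\|,\tau)$ is a semi-Montel Saks space for some locally convex Hausdorff topology $\tau\le\tau_{\|\cdot\|}$. (f) There is a norm-closed linear subspace $V\subset X^{\ast}$ such that $\sigma(X,V)$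 is Hausdorff and $B_{\|\cdot\|}$ is $\sigma(X,V)$-compact. (g) $B_{\|\cdot\|}$ is $\tau$-compact for some locally convex Hausdorff topology $\tau$ on $X$. -/

import Mathlib

open Topology

universe u w

section LocallyConvex

variable (𝕜 : Type w) [RCLike 𝕜]

/-- `τ` is a locally convex Hausdorff topology on the `𝕜`-vector space `E`: a Hausdorff linear
topology that is generated by a family of seminorms. -/
structure IsLCHausdorff {E : Type u} [AddCommGroup E] [Module 𝕜 E] (τ : TopologicalSpace E) :
    Prop where
  isTopologicalAddGroup : IsTopologicalAddGroup E
  continuousSMul : ContinuousSMul 𝕜 E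
  polynormableSpace : PolynormableSpace 𝕜 E
  t2Space : T2Space E

/-- `E` is semi-reflexive: the evaluation map from `E` to the dual of its strong dual is
surjective. In Mathlib `StrongDual 𝕜 E` is the topological dual with the topology of uniform
convergence on the (von Neumann) bounded subsets of `E`. -/
def SemiReflexiveSpace (E : Type u) [AddCommGroup E] [Module 𝕜 E] [TopologicalSpace E] : Prop :=
  ∀ F : StrongDual 𝕜 (StrongDual 𝕜 E), ∃ x : E, ∀ f : StrongDual 𝕜 E, F f = f x

/-- The topological additive group `E` is complete, with respect to its canonical uniformity. -/
def CompleteLCSpace (E : Type u) [AddCommGroup E] [TopologicalSpace E]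
    [IsTopologicalAddGroup E] : Prop :=
  @CompleteSpace E (IsTopologicalAddGroup.rightUniformSpace E)

end LocallyConvex

section Preduals

variable (𝕜 : Type w) [RCLike 𝕜] (X : Type u) [NormedAddCommGroup X] [NormedSpace 𝕜 X]

/-- `X` has an isometric Banach predual: a Banach space `Y` with an isometric isomorphism of `X`
onto the normed dual of `Y`. -/
def HasIsometricBanachPredual : Prop :=
  ∃ (Y : Type (max u w)) (_ : NormedAddCommGroup Y) (_ : NormedSpace 𝕜 Y) (_ : CompleteSpace Y),
    Nonempty (X ≃ₗᵢ[𝕜] StrongDual 𝕜 Y)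

/-- `Y` is (the first component of) an isometric prebidual of `X`: the strong dual of `Y` is
completely normable by some norm `|||·|||`, and `X` is isometrically isomorphic to the normed dual
of `(Y', |||·|||)`. Here the Banach space `Z` is the copy of `(Y', |||·|||)` under the linear
homeomorphism `e`, that is `|||f||| = ‖e f‖`. -/
def IsIsometricPrebidual (Y : Type u) [AddCommGroup Y] [Module 𝕜 Y] [TopologicalSpace Y] : Prop :=
  ∃ (Z : Type (max u w)) (_ : NormedAddCommGroup Z) (_ : NormedSpace 𝕜 Z) (_ : CompleteSpace Z)
    (_e : StrongDual 𝕜 Y ≃L[𝕜] Z), Nonempty (X ≃ₗᵢ[𝕜] StrongDual 𝕜 Z)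

/-- `X` has an isometric prebidual (which is a locally convex Hausdorff space). -/
def HasIsometricPrebidual : Prop :=
  ∃ (Y : Type u) (_ : AddCommGroup Y) (_ : Module 𝕜 Y) (τ : TopologicalSpace Y)
    (_ : IsLCHausdorff 𝕜 τ), IsIsometricPrebidual 𝕜 X Y

/-- `X` has an isometric prebidual which is a complete semi-Montel space.
(`MontelSpace` in Mathlib requires closed bounded sets to be compact, but not barrelledness; so it
is what is usually called a semi-Montel space.) -/
def HasIsometricCompleteSemiMontelPrebidual : Prop :=
  ∃ (Y : Type u) (_ : AddCommGroup Y) (_ : Module 𝕜 Y) (τ : TopologicalSpace Y)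
    (h : IsLCHausdorff 𝕜 τ),
    (haveI := h.isTopologicalAddGroup; CompleteLCSpace Y) ∧ MontelSpace 𝕜 Y ∧
      IsIsometricPrebidual 𝕜 X Y

end Preduals

section Saks

variable (𝕜 : Type w) [RCLike 𝕜] {X : Type u} [NormedAddCommGroup X] [NormedSpace 𝕜 X]

/-- The topology induced by the norm of `X`. -/
abbrev normTopology (X : Type u) [NormedAddCommGroup X] : TopologicalSpace X := inferInstance

/-- The linear topologies `γ` with `τ ≤ γ ≤ τ_‖·‖` (in the order "coarser than", which is the
reverse of Mathlib's) that coincide with `τ` on the norm-bounded subsets of `X`. -/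
def mixedTopologyCandidates (τ : TopologicalSpace X) : Set (TopologicalSpace X) :=
  {γ | @IsTopologicalAddGroup X γ _ ∧ @ContinuousSMul 𝕜 X _ _ γ ∧
    normTopology X ≤ γ ∧ γ ≤ τ ∧
    ∀ s : Set X, Bornology.IsBounded s →
      TopologicalSpace.induced ((↑) : s → X) γ = TopologicalSpace.induced ((↑) : s → X) τ}

/-- The mixed topology `γ(‖·‖, τ)`: the finest of the candidates. -/
@[reducible] def mixedTopology (τ : TopologicalSpace X) : TopologicalSpace X :=
  sInf (mixedTopologyCandidates 𝕜 τ)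

/-- `(X, ‖·‖, τ)` is a pre-Saks space. -/
structure IsPreSaksSpace (τ : TopologicalSpace X) : Prop where
  isLCHausdorff : IsLCHausdorff 𝕜 τ
  normTopology_le : normTopology X ≤ τ

/-- For a pre-Saks space the finest candidate exists, and it is the mixed topology. -/
theorem IsPreSaksSpace.isLeast_mixedTopology {τ : TopologicalSpace X}
    (h : IsPreSaksSpace 𝕜 τ) :
    IsLeast (mixedTopologyCandidates 𝕜 τ) (mixedTopology 𝕜 τ) := by
  have hτ : τ ∈ mixedTopologyCandidates 𝕜 τ :=
    ⟨h.isLCHausdorff.isTopologicalAddGroup, h.isLCHausdorff.continuousSMul, h.normTopology_le,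
      le_rfl, fun _ _ => rfl⟩
  refine ⟨⟨topologicalAddGroup_sInf fun γ hγ => hγ.1, continuousSMul_sInf fun γ hγ => hγ.2.1,
    le_sInf fun γ hγ => hγ.2.2.1, sInf_le hτ, fun s hs => ?_⟩, fun γ hγ => sInf_le hγ⟩
  refine le_antisymm (induced_mono (sInf_le hτ)) ?_
  rw [mixedTopology, sInf_eq_iInf, induced_iInf]
  refine le_iInf fun γ => ?_
  rw [induced_iInf]
  exact le_iInf fun hγ => (hγ.2.2.2.2 s hs).ge

/-- `(X, ‖·‖, τ)` is a Saks space: it is a pre-Saks space, and `τ` is generated by a directed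
system `Γ` of (continuous) seminorms such that `‖x‖ = sup_{q ∈ Γ} q(x)` for all `x`. -/
structure IsSaksSpace (τ : TopologicalSpace X) : Prop extends IsPreSaksSpace 𝕜 τ where
  exists_seminorms : ∃ Γ : Set (Seminorm 𝕜 X), Γ.Nonempty ∧ DirectedOn (· ≤ ·) Γ ∧
    WithSeminorms (fun q : Γ => (q : Seminorm 𝕜 X)) (topology := τ) ∧
    ∀ x : X, IsLUB ((fun q : Seminorm 𝕜 X => q x) '' Γ) ‖x‖

/-- `(X, ‖·‖, τ)` is a semi-reflexive Saks space: a Saks space with `(X, γ)` semi-reflexive, `γ`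
the mixed topology. -/
def IsSemiReflexiveSaksSpace (τ : TopologicalSpace X) : Prop :=
  IsSaksSpace 𝕜 τ ∧ @SemiReflexiveSpace 𝕜 _ X _ _ (mixedTopology 𝕜 τ)

/-- `(X, ‖·‖, τ)` is a semi-Montel Saks space: a Saks space with `(X, γ)` a semi-Montel space, `γ`
the mixed topology. -/
def IsSemiMontelSaksSpace (τ : TopologicalSpace X) : Prop :=
  IsSaksSpace 𝕜 τ ∧ @MontelSpace 𝕜 X _ _ _ (mixedTopology 𝕜 τ)

variable {𝕜} in
/-- The topology `σ(X, V)` on `X`, for a linear subspace `V` of the dual of `X`: the topology of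
pointwise convergence on `V`. -/
@[reducible] def sigmaTopology (V : Submodule 𝕜 (StrongDual 𝕜 X)) : TopologicalSpace X :=
  TopologicalSpace.induced (fun (x : X) (v : V) => (v : StrongDual 𝕜 X) x) Pi.topologicalSpace

end Saks

/-! A Banach predual supplies all the other objects. Conversely, a prebidual contains a Banach
predual by definition, and each of the remaining assertions makes the unit ball compact in a locally
convex Hausdorff topology.

Let X be the dual of a Banach space Y. Give X a group topology that is finer than weak-* and agrees
with it on norm-bounded sets (`IsMixedDual`). By Banach-Steinhaus its bounded sets are norm-bounded,
so they lie in weak-* compact balls. A functional that is weak-* continuous on the ball is an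
evaluation, so the strong dual is Y. Hence X is semi-Montel and semi-reflexive. The mixed topology
of weak-* qualifies, and so does uniform convergence on compact sets, which is also complete and
makes X its own prebidual.

For the converse, a Saks ball is closed because the norm is a supremum of continuous seminorms; this
settles the semi-Montel case. In the semi-reflexive case X is the dual of its mixed-continuous
functionals, and Alaoglu applies. Compactness of the ball gives a predual by Dixmier-Ng: it is the
space of functionals continuous on the compact ball. -/

/-! ### Topologies on a dual space that agree with weak-* on bounded sets -/

section MixedDual

open Filter Metric WeakDual

variable {𝕜 : Type*} [RCLike 𝕜]

/-- A functional that is bounded by `C` on the unit sphere of a subspace agrees there with a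
functional of norm at most `C`. -/
theorem exists_eqOn_norm_le {Z : Type*} [NormedAddCommGroup Z] [NormedSpace 𝕜 Z]
    (F : StrongDual 𝕜 Z) (N : Submodule 𝕜 Z) {C : ℝ} (hC : 0 ≤ C)
    (hF : ∀ z ∈ N, ‖z‖ = 1 → ‖F z‖ ≤ C) :
    ∃ G : StrongDual 𝕜 Z, (∀ z ∈ N, G z = F z) ∧ ‖G‖ ≤ C := by
  obtain ⟨G, hGF, hG⟩ := exists_extension_norm_eq N (F.comp N.subtypeL)
  refine ⟨G, fun z hz => hGF ⟨z, hz⟩, hG.trans_le ?_⟩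
  exact ContinuousLinearMap.opNorm_le_of_unit_norm hC fun z hz => hF z z.2 hz

/-- On a Banach space, a bounded functional on the dual whose restriction to the closed unit ball
is weak-* continuous is an evaluation. -/
theorem exists_eq_eval_of_continuousOn_closedBall {Y : Type*} [NormedAddCommGroup Y]
    [NormedSpace 𝕜 Y] [CompleteSpace Y] (F : StrongDual 𝕜 (StrongDual 𝕜 Y))
    (hF : ContinuousOn (fun f : WeakDual 𝕜 Y => F (toStrongDual f))
      (toStrongDual ⁻¹' closedBall 0 1)) :
    ∃ y : Y, ∀ f : StrongDual 𝕜 Y, F f = f y := by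
  have hcl : IsClosed (Set.range (NormedSpace.inclusionInDoubleDualLi 𝕜 (E := Y))) :=
    (NormedSpace.inclusionInDoubleDualLi 𝕜
      (E := Y)).isometry.isUniformInducing.isComplete_range.isClosed
  suffices h : F ∈ closure (Set.range (NormedSpace.inclusionInDoubleDualLi 𝕜 (E := Y))) by
    rw [hcl.closure_eq] at h
    obtain ⟨y, rfl⟩ := h
    exact ⟨y, fun f => rfl⟩
  refine (Metric.mem_closure_iff (α := StrongDual 𝕜 (StrongDual 𝕜 Y))).2 fun ε hε => ?_
  have h0 : {f : WeakDual 𝕜 Y | ‖F (toStrongDual f)‖ < ε / 2} ∈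
      𝓝[toStrongDual ⁻¹' closedBall 0 1] (0 : WeakDual 𝕜 Y) := by
    have := hF 0 (by simp)
    have h2 := this.norm (Iio_mem_nhds (a := ε / 2) (by simpa using half_pos hε))
    exact h2
  obtain ⟨U, hU, hUF⟩ := mem_nhdsWithin_iff_exists_mem_nhds_inter.1 h0
  obtain ⟨s, r, hr, hs⟩ := ((WeakDual.withSeminorms 𝕜 Y).mem_nhds_iff 0 U).1 hU
  -- The unit sphere of the common kernel `N` of the evaluations in `s` lies in the neighbourhood,
  -- so `F` is below `ε / 2` there. If `G` extends `F` from `N` with norm at most `ε / 2`, then `F -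
  -- G` vanishes on `N`. It is therefore a combination of evaluations, within `ε / 2` of `F`.
  let N : Submodule 𝕜 (StrongDual 𝕜 Y) :=
    ⨅ y : s, LinearMap.ker (NormedSpace.inclusionInDoubleDual 𝕜 Y y.1).toLinearMap
  have hN : ∀ f ∈ N, ∀ y ∈ s, f y = 0 := fun f hf y hy => by
    have := (Submodule.mem_iInf _).1 hf ⟨y, hy⟩
    simpa using this
  obtain ⟨G, hGF, hG⟩ := exists_eqOn_norm_le F N (half_pos hε).le fun f hfN hf => by
    refine le_of_lt (hUF ⟨hs ?_, ?_⟩ : StrongDual.toWeakDual f ∈ _)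
    · rw [Seminorm.mem_ball, sub_zero]
      refine Seminorm.finset_sup_apply_lt hr fun y hy => ?_
      simpa [hN f hfN y hy] using hr
    · simpa using hf.le
  have hspan : (F - G).toLinearMap ∈ Submodule.span 𝕜 (Set.range fun y : s =>
      (NormedSpace.inclusionInDoubleDual 𝕜 Y y.1).toLinearMap) := by
    refine mem_span_of_iInf_ker_le_ker fun f hf => ?_
    simpa [sub_eq_zero] using (hGF f hf).symm
  have hrange : ∃ y : Y, (NormedSpace.inclusionInDoubleDual 𝕜 Y y).toLinearMap =
      (F - G).toLinearMap := by
    have hle : Submodule.span 𝕜 (Set.range fun y : s =>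
      (NormedSpace.inclusionInDoubleDual 𝕜 Y y.1).toLinearMap) ≤
      LinearMap.range ((ContinuousLinearMap.coeLM 𝕜).comp
        (NormedSpace.inclusionInDoubleDual 𝕜 Y).toLinearMap) := by
      rw [Submodule.span_le]
      rintro _ ⟨y, rfl⟩
      exact ⟨y, rfl⟩
    exact hle hspan
  obtain ⟨y, hy⟩ := hrange
  refine ⟨_, ⟨y, rfl⟩, ?_⟩
  have : NormedSpace.inclusionInDoubleDualLi 𝕜 y = F - G :=
    ContinuousLinearMap.coe_injective hy
  rw [this]
  calc dist F (F - G) = ‖F - (F - G)‖ := dist_eq_norm F (F - G)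
    _ = ‖G‖ := congrArg norm (sub_sub_cancel F G)
    _ < ε := by linarith

variable {E Y : Type*} [AddCommGroup E] [Module 𝕜 E] [TopologicalSpace E]
  [NormedAddCommGroup Y] [NormedSpace 𝕜 Y]

/-- `J` identifies `E` with the dual of the normed space `Y` in such a way that the topology of `E`
is finer than the weak-* topology and coincides with it on the norm-bounded sets. -/
structure IsMixedDual (J : E ≃ₗ[𝕜] StrongDual 𝕜 Y) : Prop where
  continuous_apply : ∀ y : Y, Continuous fun x => J x y
  continuousOn_symm : ∀ r : ℝ, ContinuousOn (fun f : WeakDual 𝕜 Y => J.symm (toStrongDual f))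
    (toStrongDual ⁻¹' closedBall 0 r)

namespace IsMixedDual

variable {J : E ≃ₗ[𝕜] StrongDual 𝕜 Y}

theorem isCompact_image_closedBall (hJ : IsMixedDual J) (r : ℝ) :
    IsCompact (J.symm '' closedBall 0 r) := by
  exact (WeakDual.isCompact_closedBall (𝕜 := 𝕜) (E := Y) 0 r).image_of_continuousOn
    (hJ.continuousOn_symm r)

/-- The unit ball is a norm neighbourhood of 0 on which the norm topology is finer than weak-*; by
linearity continuity at 0 is enough. -/
theorem continuous_symm [IsTopologicalAddGroup E] (hJ : IsMixedDual J) : Continuous J.symm := by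
  refine continuous_of_continuousAt_zero J.symm ?_
  have h := (hJ.continuousOn_symm 1) 0 (by simp)
  have h2 : ContinuousOn (fun f : StrongDual 𝕜 Y => J.symm f) (closedBall 0 1) :=
    (hJ.continuousOn_symm 1).comp (f := StrongDual.toWeakDual)
      NormedSpace.Dual.toWeakDual_continuous.continuousOn fun f hf => hf
  exact h2.continuousAt (closedBall_mem_nhds 0 one_pos)

theorem isVonNBounded_image_closedBall [IsTopologicalAddGroup E] (hJ : IsMixedDual J) (r : ℝ) :
    Bornology.IsVonNBounded 𝕜 (J.symm '' closedBall 0 r) :=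
  (NormedSpace.isVonNBounded_closedBall 𝕜 _ r).image
    (⟨J.symm.toLinearMap, hJ.continuous_symm⟩ : StrongDual 𝕜 Y →L[𝕜] E)

/-- Each `J · y` is a continuous functional, so a bounded set is pointwise bounded on `Y`, and
Banach-Steinhaus applies. -/
theorem exists_norm_le [CompleteSpace Y] (hJ : IsMixedDual J) {s : Set E}
    (hs : Bornology.IsVonNBounded 𝕜 s) : ∃ C, ∀ x ∈ s, ‖J x‖ ≤ C := by
  obtain ⟨C, hC⟩ := banach_steinhaus (g := fun x : s => J x) fun y => by
    have h := hs.image (⟨(LinearMap.applyₗ y).comp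
      ((ContinuousLinearMap.coeLM 𝕜).comp J.toLinearMap), hJ.continuous_apply y⟩ : E →L[𝕜] 𝕜)
    obtain ⟨C, hC⟩ := (NormedSpace.isVonNBounded_iff 𝕜).1 h |>.exists_norm_le
    exact ⟨C, fun x => hC _ ⟨x, x.2, rfl⟩⟩
  exact ⟨C, fun x hx => hC ⟨x, hx⟩⟩

theorem montelSpace [CompleteSpace Y] (hJ : IsMixedDual J) : MontelSpace 𝕜 E where
  heine_borel s hcl hs := by
    obtain ⟨C, hC⟩ := hJ.exists_norm_le hs
    exact (hJ.isCompact_image_closedBall C).of_isClosed_subset hcl fun x hx =>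
      ⟨J x, by simpa using hC x hx, by simp⟩

/-- The evaluation at a point of the predual, as a continuous functional. -/
def eval (hJ : IsMixedDual J) : Y →ₗ[𝕜] StrongDual 𝕜 E where
  toFun y := ⟨(LinearMap.applyₗ y).comp
      ((ContinuousLinearMap.coeLM 𝕜).comp J.toLinearMap), hJ.continuous_apply y⟩
  map_add' y z := ContinuousLinearMap.ext fun x => map_add (J x) y z
  map_smul' c y := ContinuousLinearMap.ext fun x => map_smul (J x) c y

@[simp]
theorem eval_apply (hJ : IsMixedDual J) (y : Y) (x : E) : hJ.eval y x = J x y := rfl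

theorem norm_le_of_forall_eval_le (hJ : IsMixedDual J) (y : Y) {C : ℝ}
    (h : ∀ x, ‖J x‖ ≤ 1 → ‖hJ.eval y x‖ ≤ C) : ‖y‖ ≤ C := by
  obtain ⟨f, hf, hfy⟩ := exists_dual_vector'' 𝕜 y
  have := h (J.symm f) (by simpa using hf)
  simpa [hfy] using this

/-- For surjectivity: a continuous functional on `E`, composed with `J.symm`, is norm-bounded and
weak-* continuous on the unit ball, hence an evaluation. -/
theorem eval_bijective [CompleteSpace Y] [IsTopologicalAddGroup E] (hJ : IsMixedDual J) :
    Function.Bijective hJ.eval := by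
  refine ⟨(injective_iff_map_eq_zero _).2 fun y hy => ?_, fun f => ?_⟩
  · exact norm_le_zero_iff.1 (hJ.norm_le_of_forall_eval_le y fun x _ => by simp [hy])
  · obtain ⟨y, hy⟩ := exists_eq_eval_of_continuousOn_closedBall
      (f.comp (⟨J.symm.toLinearMap, hJ.continuous_symm⟩ : StrongDual 𝕜 Y →L[𝕜] E))
      (f.continuous.comp_continuousOn (hJ.continuousOn_symm 1))
    refine ⟨y, ContinuousLinearMap.ext fun x => ?_⟩
    simpa using (hy (J x)).symm

/-- The strong dual of `E` is the Banach space `Y`. -/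
noncomputable def strongDualEquiv [CompleteSpace Y] [IsTopologicalAddGroup E] (hJ : IsMixedDual J) :
    Y ≃L[𝕜] StrongDual 𝕜 E where
  toLinearEquiv := LinearEquiv.ofBijective hJ.eval hJ.eval_bijective
  continuous_toFun := by
    refine continuous_of_continuousAt_zero hJ.eval ?_
    rw [ContinuousAt, map_zero, ContinuousLinearMap.hasBasis_nhds_zero_of_basis
      (𝓝 (0 : 𝕜)).basis_sets |>.tendsto_right_iff]
    rintro ⟨s, U⟩ ⟨hs, hU⟩
    obtain ⟨ε, hε, hU⟩ := Metric.mem_nhds_iff.1 hU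
    obtain ⟨C, hC⟩ := hJ.exists_norm_le hs
    -- `C` need not be positive, hence the denominator `|C| + 1`.
    have hC' : 0 < |C| + 1 := by positivity
    filter_upwards [ball_mem_nhds (0 : Y) (div_pos hε hC')] with y hy x hx
    refine hU ?_
    rw [mem_ball_zero_iff] at hy ⊢
    calc ‖J x y‖ ≤ ‖J x‖ * ‖y‖ := (J x).le_opNorm y
      _ ≤ (|C| + 1) * ‖y‖ := by
        gcongr
        linarith [hC x hx, le_abs_self C]
      _ < ε := by rwa [lt_div_iff₀' hC'] at hy
  continuous_invFun := by
    let e := LinearEquiv.ofBijective hJ.eval hJ.eval_bijective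
    refine continuous_of_continuousAt_zero e.symm ?_
    rw [ContinuousAt, map_zero, nhds_basis_closedBall.tendsto_right_iff]
    intro ε hε
    -- Functionals bounded by `ε` on the image of the unit ball form a neighbourhood of 0 in the
    -- strong dual, and their representing vectors have norm at most `ε`.
    have hmem := ContinuousLinearMap.hasBasis_nhds_zero_of_basis (σ := RingHom.id 𝕜) (E := E)
      (nhds_basis_closedBall (x := (0 : 𝕜))) |>.mem_of_mem (i := (J.symm '' closedBall 0 1, ε))
      ⟨hJ.isVonNBounded_image_closedBall 1, hε⟩
    filter_upwards [hmem] with f hf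
    rw [mem_closedBall_zero_iff]
    refine hJ.norm_le_of_forall_eval_le _ fun x hx => ?_
    have h1 : hJ.eval (e.symm f) = f := e.apply_symm_apply f
    rw [h1]
    simpa using hf x ⟨J x, by simpa using hx, by simp⟩

theorem semiReflexiveSpace [CompleteSpace Y] [IsTopologicalAddGroup E] (hJ : IsMixedDual J) :
    SemiReflexiveSpace 𝕜 E := by
  intro F
  refine ⟨J.symm (F.comp (hJ.strongDualEquiv : Y →L[𝕜] StrongDual 𝕜 E)), fun f => ?_⟩
  obtain ⟨y, rfl⟩ := hJ.strongDualEquiv.surjective f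
  change _ = J _ y
  simp

end IsMixedDual

end MixedDual

/-! ### The weak-* topology and Saks spaces -/

section DualTopologies

open Filter Metric WeakDual

variable {𝕜 : Type*} [RCLike 𝕜]

theorem IsLCHausdorff.induced_pairing {E F : Type*} [AddCommGroup E] [Module 𝕜 E] [AddCommGroup F]
    [Module 𝕜 F] (B : E →ₗ[𝕜] F →ₗ[𝕜] 𝕜) 
    (h : @T2Space E (TopologicalSpace.induced (fun x y => B x y) Pi.topologicalSpace)) :
    IsLCHausdorff 𝕜 (TopologicalSpace.induced (fun x y => B x y) Pi.topologicalSpace) where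
  isTopologicalAddGroup := inferInstanceAs (IsTopologicalAddGroup (WeakBilin B))
  continuousSMul := inferInstanceAs (ContinuousSMul 𝕜 (WeakBilin B))
  polynormableSpace := B.weakBilin_withSeminorms.toPolynormableSpace
  t2Space := h

variable {X Y : Type*} [NormedAddCommGroup X] [NormedSpace 𝕜 X] [NormedAddCommGroup Y]
  [NormedSpace 𝕜 Y]

/-- The weak-* topology on a normed space `X` that is identified with the dual of `Y`. -/
@[reducible] noncomputable def weakStarTopology (J : X ≃ₗᵢ[𝕜] StrongDual 𝕜 Y) : TopologicalSpace X :=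
  TopologicalSpace.induced (fun x y => J x y) Pi.topologicalSpace

variable (J : X ≃ₗᵢ[𝕜] StrongDual 𝕜 Y)

theorem continuous_weakStarTopology_apply (y : Y) :
    Continuous[weakStarTopology J, inferInstance] fun x => J x y :=
  @Continuous.comp _ _ _ (weakStarTopology J) _ _ _ _ (continuous_apply (A := fun _ : Y => 𝕜) y)
    continuous_induced_dom

theorem isLCHausdorff_weakStarTopology : IsLCHausdorff 𝕜 (weakStarTopology J) :=
  IsLCHausdorff.induced_pairing ((ContinuousLinearMap.coeLM 𝕜).comp J.toLinearEquiv.toLinearMap)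
    (WeakBilin.isEmbedding (ContinuousLinearMap.coe_injective.comp J.injective)).t2Space

theorem normTopology_le_weakStarTopology : normTopology X ≤ weakStarTopology J := by
  refine continuous_iff_le_induced.1 (continuous_pi fun y => ?_)
  exact (ContinuousLinearMap.apply 𝕜 𝕜 y).continuous.comp J.continuous

theorem isCompact_closedBall_weakStarTopology :
    @IsCompact X (weakStarTopology J) (closedBall 0 1) := by
  let _ : TopologicalSpace X := weakStarTopology J
  have hc : Continuous fun f : WeakDual 𝕜 Y => J.symm (toStrongDual f) :=
    continuous_induced_rng.2 <| continuous_pi fun y => by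
      simpa [Function.comp_def] using WeakDual.eval_continuous y
  convert (WeakDual.isCompact_closedBall (𝕜 := 𝕜) (E := Y) 0 1).image hc
  ext x
  constructor
  · intro hx
    exact ⟨StrongDual.toWeakDual (J x), by simpa using hx, by simp⟩
  · rintro ⟨f, hf, rfl⟩
    simpa using hf

/-- Agreement with weak-* on balls suffices; that the mixed topology is the finest candidate plays
no role. -/
theorem isMixedDual_of_mem_mixedTopologyCandidates {γ : TopologicalSpace X}
    (hγ : γ ∈ mixedTopologyCandidates 𝕜 (weakStarTopology J)) :
    IsMixedDual (E := X) J.toLinearEquiv := by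
  obtain ⟨-, -, -, hle, hb⟩ := hγ
  refine ⟨fun y => ?_, fun r => ?_⟩
  · exact continuous_le_dom hle (continuous_weakStarTopology_apply J y)
  · rw [continuousOn_iff_continuous_domRestrict]
    let s : Set X := closedBall 0 r
    have hs := hb s isBounded_closedBall
    let g : (toStrongDual (𝕜 := 𝕜) (E := Y)) ⁻¹' closedBall 0 r → s :=
      fun f => ⟨J.symm (toStrongDual f.1), by
        have := f.2
        rw [Set.mem_preimage, mem_closedBall_zero_iff] at this
        simpa only [s, mem_closedBall_zero_iff, J.symm.norm_map] using this⟩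
    suffices h : @Continuous _ _ _ (TopologicalSpace.induced ((↑) : s → X) γ) g from
      @Continuous.comp _ _ _ _ (TopologicalSpace.induced ((↑) : s → X) γ) γ _ _
        continuous_induced_dom h
    rw [hs]
    refine continuous_induced_rng.2 (continuous_induced_rng.2 (continuous_pi fun y => ?_))
    simpa [Function.comp_def, g] using
      (WeakDual.eval_continuous y).comp continuous_subtype_val

/-- All continuous seminorms below the norm form a system closed under maxima. It generates `τ`: a
`τ`-continuous seminorm is norm-continuous, so some positive multiple of it lies below the norm. -/
theorem IsSaksSpace.of_exists_seminorm {τ : TopologicalSpace X} (hτ : IsPreSaksSpace 𝕜 τ)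
    (h : ∀ x : X, ∀ b < ‖x‖, ∃ q : Seminorm 𝕜 X, Continuous[τ, inferInstance] q ∧
      (∀ z, q z ≤ ‖z‖) ∧ b < q x) : IsSaksSpace 𝕜 τ := by
  refine ⟨hτ, {q | Continuous[τ, inferInstance] q ∧ ∀ z, q z ≤ ‖z‖}, ?_, ?_, ?_, ?_⟩
  · exact ⟨0, @continuous_const _ _ τ _ _, fun z => norm_nonneg z⟩
  · rintro p ⟨hp, hp'⟩ q ⟨hq, hq'⟩
    exact ⟨p ⊔ q, ⟨@Continuous.max _ _ _ _ _ _ _ τ hp hq, fun z => sup_le (hp' z) (hq' z)⟩,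
      le_sup_left, le_sup_right⟩
  · refine WithSeminorms.congr (t := τ)
      hτ.isLCHausdorff.polynormableSpace.withSeminorms' (fun q => ?_) fun p => ?_
    · exact ⟨{⟨q, q.2.1⟩}, 1, by simp⟩
    · obtain ⟨C, hC, hpC⟩ := Seminorm.bound_of_continuous_normedSpace p.1
        (continuous_le_dom hτ.normTopology_le p.2)
      let D : NNReal := ⟨C, hC.le⟩
      have hD : D ≠ 0 := fun h => hC.ne' (congrArg NNReal.toReal h)
      have h1 : Continuous[τ, inferInstance] (D⁻¹ • p.1) :=
        @Continuous.const_smul _ _ _ _ _ _ τ _ p.2 D⁻¹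
      have h2 : ∀ z, (D⁻¹ • p.1) z ≤ ‖z‖ := fun z => by
        change (D⁻¹ : NNReal) * p.1 z ≤ ‖z‖
        rw [NNReal.coe_inv]
        exact (inv_mul_le_iff₀ hC).2 (hpC z)
      refine ⟨{⟨D⁻¹ • p.1, h1, h2⟩}, D, ?_⟩
      rw [Finset.sup_singleton, smul_inv_smul₀ hD, Seminorm.comp_id]
  · intro x
    refine ⟨?_, fun b hb => ?_⟩
    · rintro _ ⟨q, hq, rfl⟩
      exact hq.2 x
    · by_contra! hlt
      obtain ⟨q, hq, hq', hbq⟩ := h x b hlt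
      exact absurd (hb ⟨q, ⟨hq, hq'⟩, rfl⟩) (not_le.2 hbq)

theorem isSaksSpace_weakStarTopology : IsSaksSpace 𝕜 (weakStarTopology J) := by
  refine .of_exists_seminorm
    ⟨isLCHausdorff_weakStarTopology J, normTopology_le_weakStarTopology J⟩ fun x b hb => ?_
  obtain ⟨y, hy, hby⟩ : ∃ y : Y, ‖y‖ ≤ 1 ∧ b < ‖J x y‖ := by
    by_contra! H
    have hb0 : 0 ≤ b := (norm_nonneg _).trans (H 0 (by simp))
    have := (J x).opNorm_le_of_unit_norm hb0 fun y hy => H y hy.le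
    rw [J.norm_map] at this
    linarith
  refine ⟨((ContinuousLinearMap.coeLM 𝕜).comp J.toLinearEquiv.toLinearMap |>.flip y).toSeminorm,
    ?_, fun z => ?_, hby⟩
  · exact @Continuous.norm _ _ _ (weakStarTopology J) _ (continuous_weakStarTopology_apply J y)
  · refine ((J z).le_opNorm y).trans ?_
    rw [J.norm_map]
    exact mul_le_of_le_one_right (norm_nonneg _) hy

/-! ### Uniform convergence on compact sets -/

open CompactConvergenceCLM
open scoped ComplexOrder

/-- The identification of `X` with the dual of `Y`, endowed with the compact-open topology. -/
noncomputable def compactConvergenceEquiv : X ≃ₗ[𝕜] (Y →L_c[𝕜] 𝕜) := J.toLinearEquiv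

/-- The topology of uniform convergence on the compact subsets of `Y`, on a normed space that is
identified with the dual of `Y`. -/
@[reducible] noncomputable def compactOpenTopology (J : X ≃ₗᵢ[𝕜] StrongDual 𝕜 Y) :
    TopologicalSpace X :=
  TopologicalSpace.induced (compactConvergenceEquiv J)
    (UniformConvergenceCLM.instTopologicalSpace _ _ _)

theorem isLCHausdorff_compactOpenTopology : IsLCHausdorff 𝕜 (compactOpenTopology J) where
  isTopologicalAddGroup := topologicalAddGroup_induced (compactConvergenceEquiv J)
  continuousSMul := continuousSMul_induced (compactConvergenceEquiv J).toLinearMap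
  polynormableSpace := by
    have : LocallyConvexSpace 𝕜 𝕜 := .ofBasisZero 𝕜 𝕜 (fun r => ball 0 r) (0 < ·)
      nhds_basis_ball fun r _ => convex_RCLike_iff_convex_real.2 (convex_ball 0 r)
    have : LocallyConvexSpace 𝕜 (Y →L_c[𝕜] 𝕜) :=
      UniformConvergenceCLM.locallyConvexSpace 𝕜 _ ⟨∅, isCompact_empty⟩
        (directedOn_of_sup_mem fun _ _ => IsCompact.union)
    have : ContinuousSMul ℝ (Y →L_c[𝕜] 𝕜) := IsScalarTower.continuousSMul 𝕜
    have : PolynormableSpace 𝕜 (Y →L_c[𝕜] 𝕜) := LocallyConvexSpace.toPolynormableSpace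
    exact PolynormableSpace.induced (compactConvergenceEquiv J).toLinearMap
  t2Space := @T2Space.of_injective_continuous _ _ (compactOpenTopology J) _ _ _
    (compactConvergenceEquiv J).injective continuous_induced_dom

theorem completeLCSpace_compactOpenTopology :
    @CompleteLCSpace X _ (compactOpenTopology J)
      (isLCHausdorff_compactOpenTopology J).isTopologicalAddGroup := by
  let u : UniformSpace X := .comap (compactConvergenceEquiv J)
    (UniformConvergenceCLM.instUniformSpace _ _ _)
  have : IsUniformAddGroup X := IsUniformAddGroup.comap (compactConvergenceEquiv J)
  -- The topology of `Y` is determined by its compact subsets, so limits that are uniform on compact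
  -- sets stay continuous.
  have hY : CompleteSpace (Y →L_c[𝕜] 𝕜) :=
    UniformConvergenceCLM.completeSpace _ _ CompactlyCoherentSpace.isCoherentWith
      Set.sUnion_isCompact_eq_univ
  have hu : IsTopologicalAddGroup.rightUniformSpace X = u := IsUniformAddGroup.rightUniformSpace_eq
  rw [CompleteLCSpace]
  change @CompleteSpace X (IsTopologicalAddGroup.rightUniformSpace X)
  rw [hu]
  have hi : IsUniformInducing (compactConvergenceEquiv J) := ⟨rfl⟩
  exact (hi.completeSpace_congr (compactConvergenceEquiv J).surjective).2 hY

/-- Balls of the dual are equi-Lipschitz, and on equicontinuous sets pointwise convergence is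
uniform on compact sets. -/
theorem isMixedDual_compactOpenTopology :
    @IsMixedDual 𝕜 _ X Y _ _ (compactOpenTopology J) _ _ J.toLinearEquiv := by
  let _ : TopologicalSpace X := compactOpenTopology J
  refine ⟨fun y => ?_, fun r => ?_⟩
  · exact (continuous_eval_const (F := Y →L_c[𝕜] 𝕜) y).comp
      (continuous_induced_dom (f := compactConvergenceEquiv J))
  · rw [continuousOn_iff_continuous_domRestrict]
    refine continuous_induced_rng.2 ?_
    refine (UniformConvergenceCLM.isEmbedding_coeFn (RingHom.id 𝕜) 𝕜 _).continuous_iff.2 ?_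
    let F : (toStrongDual (𝕜 := 𝕜) (E := Y)) ⁻¹' closedBall 0 r → Y → 𝕜 := fun f => f.1
    have hF : UniformEquicontinuous F := by
      refine LipschitzWith.uniformEquicontinuous F r.toNNReal fun f => ?_
      refine (toStrongDual f.1).lipschitz.weaken ?_
      have hf : ‖toStrongDual f.1‖ ≤ r := by
        have := f.2
        rwa [Set.mem_preimage, mem_closedBall_zero_iff] at this
      exact NNReal.le_toNNReal_of_coe_le hf
    have := (EquicontinuousOn.isInducing_uniformOnFun_iff_pi (F := F) Set.sUnion_isCompact_eq_univ
      (fun K hK => hK) (fun K _ => hF.equicontinuous.equicontinuousOn K)).2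
      (IsInducing.comp ⟨rfl⟩ .subtypeVal)
    convert! this.continuous using 1
    ext f
    change (J (J.symm (toStrongDual f.1)) : Y → 𝕜) = f.1
    rw [J.apply_symm_apply]
    rfl

end DualTopologies

/-! ### Preduals as spaces of functionals; the Dixmier-Ng theorem -/

section Duality

open Filter Metric WeakDual

variable {𝕜 : Type w} [RCLike 𝕜]

theorem Seminorm.exists_strongDual_apply_eq {E : Type*} [AddCommGroup E] [Module 𝕜 E]
    [TopologicalSpace E] [PolynormableSpace 𝕜 E] {p : Seminorm 𝕜 E} (hp : Continuous p) (x : E) :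
    ∃ g : StrongDual 𝕜 E, ‖g x‖ = p x ∧ ∀ z, ‖g z‖ ≤ p z := by
  rcases eq_or_ne x 0 with rfl | hx
  · exact ⟨0, by simp, fun z => by simp⟩
  · let f : Module.Dual 𝕜 (Submodule.span 𝕜 {x}) :=
      ((p x : ℝ) : 𝕜) • (LinearEquiv.coord 𝕜 E x hx : Submodule.span 𝕜 {x} →ₗ[𝕜] 𝕜)
    have hf : ∀ z, ‖f z‖ = p z := fun z => by
      have h1 : ‖f z‖ = ‖LinearEquiv.coord 𝕜 E x hx z‖ * p x := by
        change ‖((p x : ℝ) : 𝕜) * LinearEquiv.coord 𝕜 E x hx z‖ = _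
        rw [norm_mul, RCLike.norm_of_nonneg (apply_nonneg p x), mul_comm]
      rw [h1, ← map_smul_eq_mul p, LinearEquiv.coord_apply_smul]
    obtain ⟨g, hgf, hg⟩ := Module.Dual.exists_continuous_extension_of_le_seminorm
      (Submodule.span 𝕜 {x}) f hp fun z => (hf z).le
    refine ⟨g, ?_, hg⟩
    have := hgf ⟨x, Submodule.mem_span_singleton_self x⟩
    rw [this, hf]

variable {X : Type u} {W : Type*} [NormedAddCommGroup X] [NormedSpace 𝕜 X] [NormedAddCommGroup W]
  [NormedSpace 𝕜 W]

/-- The canonical map of `X` into the dual of a normed space `W` of functionals on `X`. -/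
noncomputable def toDualOfFunctionals (ι : W →ₗᵢ[𝕜] StrongDual 𝕜 X) : X →L[𝕜] StrongDual 𝕜 W :=
  ι.toContinuousLinearMap.flip

@[simp]
theorem toDualOfFunctionals_apply (ι : W →ₗᵢ[𝕜] StrongDual 𝕜 X) (x : X) (w : W) :
    toDualOfFunctionals ι x w = ι w x := rfl

theorem norm_toDualOfFunctionals_le (ι : W →ₗᵢ[𝕜] StrongDual 𝕜 X) (x : X) :
    ‖toDualOfFunctionals ι x‖ ≤ ‖x‖ := by
  refine ContinuousLinearMap.opNorm_le_bound _ (norm_nonneg x) fun w => ?_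
  rw [toDualOfFunctionals_apply, mul_comm, ← ι.norm_map w]
  exact (ι w).le_opNorm x

theorem nonempty_linearIsometryEquiv_of_norming (ι : W →ₗᵢ[𝕜] StrongDual 𝕜 X)
    (hι : ∀ x : X, ∀ b < ‖x‖, ∃ w : W, ‖w‖ ≤ 1 ∧ b < ‖ι w x‖)
    (hsurj : Function.Surjective (toDualOfFunctionals ι)) :
    Nonempty (X ≃ₗᵢ[𝕜] StrongDual 𝕜 W) := by
  have hnorm : ∀ x, ‖toDualOfFunctionals ι x‖ = ‖x‖ := fun x => by
    refine le_antisymm (norm_toDualOfFunctionals_le ι x) (le_of_forall_lt fun b hb => ?_)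
    obtain ⟨w, hw, hbw⟩ := hι x b hb
    exact hbw.trans_le (((toDualOfFunctionals ι x).le_opNorm w).trans
      (mul_le_of_le_one_right (norm_nonneg _) hw))
  exact ⟨LinearIsometryEquiv.ofSurjective ⟨(toDualOfFunctionals ι).toLinearMap, hnorm⟩ hsurj⟩

/-- By scaling, each `φ` has a preimage of norm at most `‖φ‖`. For the image of `x`, injectivity
makes that preimage `x` itself, so the map is isometric. -/
theorem nonempty_linearIsometryEquiv_of_closedBall (ι : W →ₗᵢ[𝕜] StrongDual 𝕜 X)
    (hinj : Function.Injective (toDualOfFunctionals ι))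
    (hball : ∀ φ : StrongDual 𝕜 W, ‖φ‖ ≤ 1 → ∃ x, ‖x‖ ≤ 1 ∧ toDualOfFunctionals ι x = φ) :
    Nonempty (X ≃ₗᵢ[𝕜] StrongDual 𝕜 W) := by
  have key : ∀ φ : StrongDual 𝕜 W, ∃ x, ‖x‖ ≤ ‖φ‖ ∧ toDualOfFunctionals ι x = φ := fun φ => by
    rcases eq_or_ne φ 0 with rfl | hφ
    · exact ⟨0, by simp, map_zero _⟩
    · have hφ' : ((‖φ‖ : ℝ) : 𝕜) ≠ 0 := by simpa using hφ
      obtain ⟨x, hx, hxφ⟩ := hball (((‖φ‖ : ℝ) : 𝕜)⁻¹ • φ) (by simp [norm_smul, hφ])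
      refine ⟨((‖φ‖ : ℝ) : 𝕜) • x, ?_, ?_⟩
      · rw [norm_smul, RCLike.norm_ofReal, abs_norm]
        exact mul_le_of_le_one_right (norm_nonneg _) hx
      · rw [map_smul, hxφ, smul_inv_smul₀ hφ']
  have hnorm : ∀ x, ‖toDualOfFunctionals ι x‖ = ‖x‖ := fun x => by
    refine le_antisymm (norm_toDualOfFunctionals_le ι x) ?_
    obtain ⟨z, hz, hzx⟩ := key (toDualOfFunctionals ι x)
    rwa [hinj hzx] at hz
  exact ⟨LinearIsometryEquiv.ofSurjective ⟨(toDualOfFunctionals ι).toLinearMap, hnorm⟩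
    fun φ => (key φ).imp fun _ h => h.2⟩

theorem Submodule.exists_linearIsometry_range_eq {D : Type u} [NormedAddCommGroup D]
    [NormedSpace 𝕜 D] [CompleteSpace D] (V : Submodule 𝕜 D) :
    ∃ (W : Type u) (_ : NormedAddCommGroup W) (_ : NormedSpace 𝕜 W) (ι : W →ₗᵢ[𝕜] D),
      (∀ f, f ∈ V ↔ ∃ w, ι w = f) ∧ (IsClosed (V : Set D) → CompleteSpace W) :=
  ⟨V, inferInstance, inferInstance, V.subtypeₗᵢ, fun f => by simp, fun h => h.completeSpace_coe⟩

/-- `W` is the image of the dual of `E` in the normed dual of `X`; it may be incomplete. A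
functional on `W` pulls back continuously to the strong dual of `E`, where semi-reflexivity
represents it by a point. -/
theorem exists_linearIsometryEquiv_of_semiReflexiveSpace {E : Type*} [AddCommGroup E] [Module 𝕜 E]
    [TopologicalSpace E] (i : X →L[𝕜] E) (hi : Function.Surjective i)
    (hE : SemiReflexiveSpace 𝕜 E)
    (hnorming : ∀ x : X, ∀ b < ‖x‖, ∃ g : StrongDual 𝕜 E, (∀ z, ‖g (i z)‖ ≤ ‖z‖) ∧ b < ‖g (i x)‖) :
    ∃ (W : Type (max u w)) (_ : NormedAddCommGroup W) (_ : NormedSpace 𝕜 W),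
      Nonempty (X ≃ₗᵢ[𝕜] StrongDual 𝕜 W) := by
  let P : StrongDual 𝕜 E →L[𝕜] StrongDual 𝕜 X := ContinuousLinearMap.precomp 𝕜 i
  obtain ⟨W, _, _, ι, hι, -⟩ := (LinearMap.range P.toLinearMap).exists_linearIsometry_range_eq
  have hmem : ∀ f, ∃ w, ι w = P f := fun f => (hι _).1 ⟨f, rfl⟩
  refine ⟨W, _, _, nonempty_linearIsometryEquiv_of_norming ι (fun x b hb => ?_) fun φ => ?_⟩
  · obtain ⟨g, hg, hbg⟩ := hnorming x b hb
    obtain ⟨w, hw⟩ := hmem g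
    refine ⟨w, ?_, by rw [hw]; exact hbg⟩
    rw [← ι.norm_map, hw]
    exact ContinuousLinearMap.opNorm_le_bound _ zero_le_one fun z => by
      simpa [P] using hg z
  · choose r hr using hmem
    let R : StrongDual 𝕜 E →ₗ[𝕜] W :=
      { toFun := r
        map_add' := fun f g => ι.injective (by simp [hr])
        map_smul' := fun c f => ι.injective (by simp [hr]) }
    have hR : Continuous R :=
      ι.isometry.isEmbedding.continuous_iff.2 (P.continuous.congr fun f => (hr f).symm)
    obtain ⟨e, he⟩ := hE (φ.comp ⟨R, hR⟩)
    obtain ⟨x, rfl⟩ := hi e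
    refine ⟨x, ContinuousLinearMap.ext fun w => ?_⟩
    obtain ⟨f, hf⟩ := (hι (ι w)).2 ⟨w, rfl⟩
    have hw : w = r f := ι.injective ((hr f).trans hf).symm
    have hfx : φ (r f) = f (i x) := he f
    rw [toDualOfFunctionals_apply, hw, hfx, hr]
    rfl

/-- The functionals on `X` that are continuous on the closed unit ball for the topology that is
carried over from `E`. -/
def ballContinuousDual {E : Type*} [AddCommGroup E] [Module 𝕜 E] [TopologicalSpace E]
    (i : X ≃ₗ[𝕜] E) : Submodule 𝕜 (StrongDual 𝕜 X) where
  carrier := {f | ContinuousOn (fun e => f (i.symm e)) (i '' closedBall 0 1)}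
  zero_mem' := continuousOn_const
  add_mem' hf hg := ContinuousOn.add hf hg
  smul_mem' c _ hf := ContinuousOn.const_smul hf c

/-- Norm limits of functionals are uniform limits on the unit ball. -/
theorem isClosed_ballContinuousDual {E : Type*} [AddCommGroup E] [Module 𝕜 E] [TopologicalSpace E]
    (i : X ≃ₗ[𝕜] E) : IsClosed (ballContinuousDual i : Set (StrongDual 𝕜 X)) := by
  refine isClosed_of_closure_subset fun f hf => ?_
  refine continuousOn_of_uniform_approx_of_continuousOn fun u hu => ?_
  obtain ⟨ε, hε, hu⟩ := Metric.mem_uniformity_dist.1 hu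
  obtain ⟨g, hg, hfg⟩ := (Metric.mem_closure_iff (α := StrongDual 𝕜 X)).1 hf ε hε
  refine ⟨_, hg, ?_⟩
  rintro _ ⟨x, hx, rfl⟩
  refine hu ?_
  rw [mem_closedBall_zero_iff] at hx
  rw [i.symm_apply_apply]
  calc dist (f x) (g x) = ‖(f - g) x‖ := by rw [dist_eq_norm]; rfl
    _ ≤ ‖f - g‖ * ‖x‖ := (f - g).le_opNorm x
    _ ≤ ‖f - g‖ := mul_le_of_le_one_right (norm_nonneg _) hx
    _ < ε := by rwa [dist_eq_norm] at hfg

theorem WeakDual.exists_eval_separating {S : Set (WeakDual 𝕜 W)} (hS : Convex ℝ S)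
    (hcl : IsClosed S) {φ : WeakDual 𝕜 W} (hφ : φ ∉ S) :
    ∃ (w : W) (c : ℝ), (∀ ψ ∈ S, RCLike.re (ψ w) < c) ∧ c < RCLike.re (φ w) := by
  have : LocallyConvexSpace ℝ (WeakDual 𝕜 W) :=
    WeakBilin.locallyConvexSpace (B := topDualPairing 𝕜 W)
  have hsep := RCLike.geometric_hahn_banach_closed_point (𝕜 := 𝕜) (E := WeakDual 𝕜 W) hS hcl hφ
  obtain ⟨f, c, hf, hfφ⟩ := hsep
  obtain ⟨w, hw⟩ := LinearMap.dualEmbedding_surjective (topDualPairing 𝕜 W) f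
  have hfw : ∀ ψ : WeakDual 𝕜 W, f ψ = ψ w := fun ψ => (DFunLike.congr_fun hw ψ).symm
  exact ⟨w, c, fun ψ hψ => hfw ψ ▸ hf ψ hψ, hfw φ ▸ hfφ⟩

/-- The **Dixmier-Ng theorem**. -/
theorem exists_linearIsometryEquiv_of_isCompact_closedBall {E : Type*} [AddCommGroup E] [Module 𝕜 E]
    [TopologicalSpace E] [IsTopologicalAddGroup E] [ContinuousSMul 𝕜 E] [PolynormableSpace 𝕜 E]
    [T2Space E] (i : X ≃ₗ[𝕜] E) (hi : IsCompact (i '' closedBall 0 1)) :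
    ∃ (V : Type (max u w)) (_ : NormedAddCommGroup V) (_ : NormedSpace 𝕜 V) (_ : CompleteSpace V),
      Nonempty (X ≃ₗᵢ[𝕜] StrongDual 𝕜 V) := by
  obtain ⟨V, _, _, ι, hι, hV⟩ := (ballContinuousDual i).exists_linearIsometry_range_eq
  -- Compact sets are bounded, so `i` is continuous for the norm, and continuous functionals on `E`
  -- restrict to members of `V`.
  let I : X →L[𝕜] E := i.toLinearMap.clmOfExistsBoundedImage
    ⟨closedBall 0 1, closedBall_mem_nhds 0 one_pos, hi.isVonNBounded 𝕜⟩
  let K := toDualOfFunctionals ι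
  refine ⟨V, _, _, hV (isClosed_ballContinuousDual i), nonempty_linearIsometryEquiv_of_closedBall ι
    ((injective_iff_map_eq_zero _).2 fun x hx => ?_) fun φ hφ => ?_⟩
  · by_contra hx0
    obtain ⟨p, hp⟩ := (PolynormableSpace.withSeminorms 𝕜 E).separating_of_T1 (i x)
      (by simpa using hx0)
    obtain ⟨g, hgx, -⟩ := Seminorm.exists_strongDual_apply_eq p.2 (i x)
    have hgV : g.comp I ∈ ballContinuousDual i := by
      have : Continuous fun e => (g.comp I) (i.symm e) :=
        g.continuous.congr fun e => congrArg g (i.apply_symm_apply e).symm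
      exact this.continuousOn
    obtain ⟨v, hv⟩ := (hι _).1 hgV
    have : K x v = 0 := by rw [show K x = 0 from hx]; rfl
    rw [toDualOfFunctionals_apply, hv] at this
    exact hp (hgx.symm.trans (norm_eq_zero.2 this))
  · let S : Set (WeakDual 𝕜 V) := (fun x => StrongDual.toWeakDual (K x)) '' closedBall 0 1
    have hS : IsCompact S := by
      have hc : ContinuousOn (fun e => StrongDual.toWeakDual (K (i.symm e)))
          (i '' closedBall 0 1) := by
        rw [continuousOn_iff_continuous_domRestrict]
        exact WeakDual.continuous_of_continuous_eval fun v =>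
          continuousOn_iff_continuous_domRestrict.1 ((hι (ι v)).2 ⟨v, rfl⟩)
      convert! hi.image_of_continuousOn hc using 1
      rw [Set.image_image]
      simp [S]
    have hconv : Convex ℝ S := by
      rintro _ ⟨x, hx, rfl⟩ _ ⟨y, hy, rfl⟩ a b ha hb hab
      rw [mem_closedBall_zero_iff] at hx hy
      refine ⟨(a : 𝕜) • x + (b : 𝕜) • y, ?_, ?_⟩
      · rw [mem_closedBall_zero_iff, ← hab]
        refine (norm_add_le _ _).trans (add_le_add ?_ ?_)
        · rw [norm_smul, RCLike.norm_of_nonneg ha]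
          exact mul_le_of_le_one_right ha hx
        · rw [norm_smul, RCLike.norm_of_nonneg hb]
          exact mul_le_of_le_one_right hb hy
      · refine DFunLike.ext _ _ fun v => ?_
        change ι v ((a : 𝕜) • x + (b : 𝕜) • y) = a • ι v x + b • ι v y
        simp only [map_add, map_smul, RCLike.real_smul_eq_coe_smul (K := 𝕜)]
    by_contra! hnot
    have hφS : StrongDual.toWeakDual φ ∉ S := by
      rintro ⟨x, hx, hxφ⟩
      exact hnot x (by simpa using hx) (StrongDual.toWeakDual.injective hxφ)
    obtain ⟨v, c, hvS, hvφ⟩ := WeakDual.exists_eval_separating hconv hS.isClosed hφS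
    have hre : ∀ x : X, ‖x‖ ≤ 1 → RCLike.re (ι v x) < c := fun x hx =>
      hvS _ ⟨x, by simpa using hx, rfl⟩
    -- Rotating by a unimodular scalar turns the bound on real parts into a norm bound; then `c < re
    -- (φ v) ≤ ‖v‖ ≤ c` is absurd.
    have hv : ‖v‖ ≤ c := by
      have hc : 0 < c := by simpa using hre 0 (by simp)
      rw [← ι.norm_map]
      refine ContinuousLinearMap.opNorm_le_of_unit_norm hc.le fun x hx => ?_
      obtain ⟨k, hk, hkx⟩ := RCLike.exists_norm_eq_mul_self (ι v x)
      have := hre (k • x) (by rw [norm_smul, hk, hx, one_mul])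
      rw [map_smul, smul_eq_mul, ← hkx, RCLike.ofReal_re] at this
      exact this.le
    have h1 : c < RCLike.re (φ v) := hvφ
    have h2 : RCLike.re (φ v) ≤ ‖v‖ := (RCLike.re_le_norm _).trans
      ((φ.le_opNorm v).trans (mul_le_of_le_one_left (norm_nonneg v) hφ))
    linarith

end Duality

/-! ### The implications between the assertions -/

section Implications

open Metric

variable {𝕜 : Type w} [RCLike 𝕜] {X : Type u} [NormedAddCommGroup X] [NormedSpace 𝕜 X]

theorem HasIsometricBanachPredual.hasIsometricCompleteSemiMontelPrebidual
    (h : HasIsometricBanachPredual 𝕜 X) : HasIsometricCompleteSemiMontelPrebidual 𝕜 X := by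
  obtain ⟨Y, _, _, _, ⟨J⟩⟩ := h
  have hJ := isMixedDual_compactOpenTopology J
  have hX := isLCHausdorff_compactOpenTopology J
  have hg := hX.isTopologicalAddGroup
  exact ⟨X, inferInstance, inferInstance, compactOpenTopology J, hX,
    completeLCSpace_compactOpenTopology J,
    @IsMixedDual.montelSpace _ _ _ _ _ _ (compactOpenTopology J) _ _ _ _ hJ,
    Y, _, _, ‹_›,
    (@IsMixedDual.strongDualEquiv _ _ _ _ _ _ (compactOpenTopology J) _ _ _ _ hg hJ).symm, ⟨J⟩⟩

theorem HasIsometricCompleteSemiMontelPrebidual.hasIsometricPrebidual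
    (h : HasIsometricCompleteSemiMontelPrebidual 𝕜 X) : HasIsometricPrebidual 𝕜 X := by
  obtain ⟨Y, _, _, τ, hτ, -, -, h⟩ := h
  exact ⟨Y, _, _, τ, hτ, h⟩

theorem HasIsometricPrebidual.hasIsometricBanachPredual
    (h : HasIsometricPrebidual 𝕜 X) : HasIsometricBanachPredual 𝕜 X := by
  obtain ⟨Y, _, _, τ, hτ, Z, _, _, _, _, hZ⟩ := h
  exact ⟨Z, _, _, ‹_›, hZ⟩

theorem HasIsometricBanachPredual.exists_isSemiReflexiveSaksSpace
    (h : HasIsometricBanachPredual 𝕜 X) :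
    ∃ τ : TopologicalSpace X, IsLCHausdorff 𝕜 τ ∧ normTopology X ≤ τ ∧
      IsSemiReflexiveSaksSpace 𝕜 τ := by
  obtain ⟨Y, _, _, _, ⟨J⟩⟩ := h
  have hS := isSaksSpace_weakStarTopology J
  have hγ := hS.toIsPreSaksSpace.isLeast_mixedTopology.1
  exact ⟨weakStarTopology J, hS.isLCHausdorff, hS.normTopology_le, hS,
    @IsMixedDual.semiReflexiveSpace _ _ _ _ _ _ (mixedTopology 𝕜 (weakStarTopology J)) _ _ _ _
      hγ.1 (isMixedDual_of_mem_mixedTopologyCandidates J hγ)⟩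

theorem HasIsometricBanachPredual.exists_isSemiMontelSaksSpace
    (h : HasIsometricBanachPredual 𝕜 X) :
    ∃ τ : TopologicalSpace X, IsLCHausdorff 𝕜 τ ∧ normTopology X ≤ τ ∧
      IsSemiMontelSaksSpace 𝕜 τ := by
  obtain ⟨Y, _, _, _, ⟨J⟩⟩ := h
  have hS := isSaksSpace_weakStarTopology J
  have hγ := hS.toIsPreSaksSpace.isLeast_mixedTopology.1
  exact ⟨weakStarTopology J, hS.isLCHausdorff, hS.normTopology_le, hS,
    @IsMixedDual.montelSpace _ _ _ _ _ _ (mixedTopology 𝕜 (weakStarTopology J)) _ _ _ _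
      (isMixedDual_of_mem_mixedTopologyCandidates J hγ)⟩

theorem HasIsometricBanachPredual.exists_isCompact_sigmaTopology
    (h : HasIsometricBanachPredual 𝕜 X) :
    ∃ V : Submodule 𝕜 (StrongDual 𝕜 X), IsClosed (V : Set (StrongDual 𝕜 X)) ∧
      @T2Space X (sigmaTopology V) ∧ @IsCompact X (sigmaTopology V) (closedBall (0 : X) 1) := by
  obtain ⟨Y, _, _, _, ⟨J⟩⟩ := h
  -- `V` is the canonical copy of `Y` in the dual of `X`, closed because it is complete.
  let T : Y →ₗᵢ[𝕜] StrongDual 𝕜 X :=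
    { toLinearMap := (ContinuousLinearMap.precomp 𝕜 (J : X →L[𝕜] StrongDual 𝕜 Y)).toLinearMap.comp
        (NormedSpace.inclusionInDoubleDual 𝕜 Y).toLinearMap
      norm_map' := fun y =>
        (ContinuousLinearMap.opNorm_comp_linearIsometryEquiv _ J).trans
          ((NormedSpace.inclusionInDoubleDualLi 𝕜).norm_map y) }
  have hT : ∀ y x, T y x = J x y := fun y x => rfl
  let V := LinearMap.range T.toLinearMap
  refine ⟨V, T.isometry.isUniformInducing.isComplete_range.isClosed, ?_, ?_⟩
  · refine @T2Space.of_injective_continuous X (V → 𝕜) (sigmaTopology V) _ _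
      (fun x v => (v : StrongDual 𝕜 X) x) (fun x z hxz => J.injective ?_) continuous_induced_dom
    exact ContinuousLinearMap.ext fun y => congrFun hxz ⟨T y, y, rfl⟩
  · have hle : weakStarTopology J ≤ sigmaTopology V := by
      refine continuous_iff_le_induced.1 ?_
      refine (@continuous_pi_iff _ _ _ (weakStarTopology J) _ _).2 ?_
      rintro ⟨_, y, rfl⟩
      exact continuous_weakStarTopology_apply J y
    simpa using @IsCompact.image _ _ (weakStarTopology J) (sigmaTopology V) _ _
      (isCompact_closedBall_weakStarTopology J) (continuous_id_of_le hle)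

theorem isLCHausdorff_sigmaTopology (V : Submodule 𝕜 (StrongDual 𝕜 X))
    (hV : @T2Space X (sigmaTopology V)) : IsLCHausdorff 𝕜 (sigmaTopology V) := by
  let B : X →ₗ[𝕜] V →ₗ[𝕜] 𝕜 := ((ContinuousLinearMap.coeLM 𝕜).comp V.subtype).flip
  have h := IsLCHausdorff.induced_pairing (E := X) (F := V) B
  exact h hV

theorem hasIsometricBanachPredual_of_isCompact_closedBall {τ : TopologicalSpace X}
    (hτ : IsLCHausdorff 𝕜 τ) (h : @IsCompact X τ (closedBall (0 : X) 1)) :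
    HasIsometricBanachPredual 𝕜 X :=
  @exists_linearIsometryEquiv_of_isCompact_closedBall 𝕜 _ X _ _ X _ _ τ hτ.isTopologicalAddGroup
    hτ.continuousSMul hτ.polynormableSpace hτ.t2Space (LinearEquiv.refl 𝕜 X) 
    (@IsCompact.image _ _ τ τ _ _ h (@continuous_id _ τ))

theorem IsSemiMontelSaksSpace.isCompact_closedBall {τ : TopologicalSpace X}
    (h : IsSemiMontelSaksSpace 𝕜 τ) : @IsCompact X τ (closedBall (0 : X) 1) := by
  obtain ⟨hS, hM⟩ := h
  obtain ⟨-, -, hnorm, hle, -⟩ := hS.toIsPreSaksSpace.isLeast_mixedTopology.1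
  obtain ⟨Γ, -, -, hΓ, hlub⟩ := hS.exists_seminorms
  have hcl : IsClosed[τ] (closedBall (0 : X) 1) := by
    have : closedBall (0 : X) 1 = ⋂ q : Γ, {x | q.1 x ≤ 1} := by
      ext x
      rw [mem_closedBall_zero_iff, isLUB_le_iff (hlub x)]
      simp [upperBounds]
    rw [this]
    exact @isClosed_iInter _ _ τ _ fun q => @isClosed_le _ _ _ _ _ τ _ _
      (hΓ.continuous_seminorm q) (@continuous_const _ _ τ _ _)
  have hγ := hM.heine_borel (closedBall (0 : X) 1) (hcl.mono hle)
    ((NormedSpace.isVonNBounded_closedBall 𝕜 X 1).of_topologicalSpace_le hnorm)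
  simpa using @IsCompact.image _ _ (mixedTopology 𝕜 τ) τ _ _ hγ (continuous_id_of_le hle)

/-- The seminorms of the Saks system are attained by continuous functionals of norm at most 1, so
these are norming. The normed predual obtained may be incomplete, but Alaoglu needs no completeness.
-/
theorem IsSemiReflexiveSaksSpace.exists_isCompact_closedBall {τ : TopologicalSpace X}
    (h : IsSemiReflexiveSaksSpace 𝕜 τ) :
    ∃ τ : TopologicalSpace X, IsLCHausdorff 𝕜 τ ∧ @IsCompact X τ (closedBall (0 : X) 1) := by
  obtain ⟨hS, hR⟩ := h
  obtain ⟨-, -, hnorm, hle, -⟩ := hS.toIsPreSaksSpace.isLeast_mixedTopology.1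
  obtain ⟨Γ, -, -, hΓ, hlub⟩ := hS.exists_seminorms
  let i : @ContinuousLinearMap 𝕜 𝕜 _ _ (RingHom.id 𝕜) X (normTopology X) _ X
      (mixedTopology 𝕜 τ) _ _ _ :=
    @ContinuousLinearMap.mk 𝕜 𝕜 _ _ (RingHom.id 𝕜) X (normTopology X) _ X
      (mixedTopology 𝕜 τ) _ _ _
      LinearMap.id (continuous_id_of_le hnorm)
  obtain ⟨W, _, _, ⟨J⟩⟩ := @exists_linearIsometryEquiv_of_semiReflexiveSpace 𝕜 _ X _ _ X _ _
    (mixedTopology 𝕜 τ) i Function.surjective_id hR fun x b hb => by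
      obtain ⟨_, ⟨q, hq, rfl⟩, hbq⟩ := (lt_isLUB_iff (hlub x)).1 hb
      obtain ⟨g, hgx, hg⟩ := @Seminorm.exists_strongDual_apply_eq 𝕜 _ X _ _ τ
        hS.isLCHausdorff.polynormableSpace q (hΓ.continuous_seminorm ⟨q, hq⟩) x
      refine ⟨@ContinuousLinearMap.mk 𝕜 𝕜 _ _ (RingHom.id 𝕜) X (mixedTopology 𝕜 τ) _ 𝕜 _ _ _ _
        g.toLinearMap (continuous_le_dom hle g.cont), fun z => ?_, ?_⟩
      · exact (hg z).trans ((hlub z).1 ⟨q, hq, rfl⟩)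
      · exact hbq.trans_eq hgx.symm
  exact ⟨weakStarTopology J, isLCHausdorff_weakStarTopology J,
    isCompact_closedBall_weakStarTopology J⟩

end Implications

theorem corollary3 (𝕜 : Type w) [RCLike 𝕜] (X : Type u) [NormedAddCommGroup X]
    [NormedSpace 𝕜 X] :
    List.TFAE [
      HasIsometricBanachPredual 𝕜 X,
      HasIsometricCompleteSemiMontelPrebidual 𝕜 X,
      HasIsometricPrebidual 𝕜 X,
      ∃ τ : TopologicalSpace X, IsLCHausdorff 𝕜 τ ∧ normTopology X ≤ τ ∧
        IsSemiReflexiveSaksSpace 𝕜 τ,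
      ∃ τ : TopologicalSpace X, IsLCHausdorff 𝕜 τ ∧ normTopology X ≤ τ ∧
        IsSemiMontelSaksSpace 𝕜 τ,
      ∃ V : Submodule 𝕜 (StrongDual 𝕜 X), IsClosed (V : Set (StrongDual 𝕜 X)) ∧
        @T2Space X (sigmaTopology V) ∧
        @IsCompact X (sigmaTopology V) (Metric.closedBall (0 : X) 1),
      ∃ τ : TopologicalSpace X, IsLCHausdorff 𝕜 τ ∧
        @IsCompact X τ (Metric.closedBall (0 : X) 1)] := by
  tfae_have 1 → 2 := fun h => h.hasIsometricCompleteSemiMontelPrebidual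
  tfae_have 2 → 3 := fun h => h.hasIsometricPrebidual
  tfae_have 3 → 1 := fun h => h.hasIsometricBanachPredual
  tfae_have 1 → 4 := fun h => h.exists_isSemiReflexiveSaksSpace
  tfae_have 4 → 7 := fun ⟨_, _, _, h⟩ => h.exists_isCompact_closedBall
  tfae_have 1 → 5 := fun h => h.exists_isSemiMontelSaksSpace
  tfae_have 5 → 7 := fun ⟨τ, hτ, _, h⟩ => ⟨τ, hτ, h.isCompact_closedBall⟩
  tfae_have 1 → 6 := fun h => h.exists_isCompact_sigmaTopology
  tfae_have 6 → 7 := fun ⟨V, _, hV, h⟩ =>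
    ⟨sigmaTopology V, isLCHausdorff_sigmaTopology V hV, h⟩
  tfae_have 7 → 1 := fun ⟨_, hτ, h⟩ => hasIsometricBanachPredual_of_isCompact_closedBall hτ h
  tfae_finish
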